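/- Let $G=(V,E)$ be an undirected loopless multigraph with edge weights in $[0,1]$ whose edges arrive online, one by one. A coloring of the edges is proper if, at every vertex, the incident edges of any one color have total weight at most $1$. Let $t$ be the maximum, over all vertices, of the number of neighbors of the vertex, and let $m$ be the maximum, over all vertices $v$, of the minimum number of unit-sized bins into which the weights of the edges incident to $v$ can be packed. Consider the following online algorithm, which colors each edge irrevocably on arrival with a color from $\{1,2,\dots\}$. Edges are divided into types according to their weights. For each pair of vertices and each type there is at most one open color. When an edge $e=uv$ of type $i$ arrives and there is an open color of type $i$ between $u$ and $v$ with which $e$ can be colored without violating properness, $e$ receives this color. Otherwise the open color of type $i$ between $u$ and $v$ (if there is one) is closed, and $e$ receives the least color that is empty for both $u$ and $v$, that is, neither open nor closed between $u$ or $v$ and any other vertex; this color becomes the open color of type $i$ between $u$ and $v$. With NEXT-FIT, all edges have the same type. With HARMONIC$_{12}$ there are $12$ types: type $i$ consists of the weights in $(\frac1{i+1},\frac1i]$ for $1\le i\le 11$, and type $12$ of the weights in $[0,\frac1{12}]$. Then the algorithm always produces a proper coloring. With HARMONIC$_{12}$ it uses only colors from $\{1,\dots,\lfloor 1.693\cdot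 2m+24t\rfloor\}$, and with NEXT-FIT only colors from $\{1,\dots,4m+2t\}$. Consequently, if $t=o(m)$, that is, on the class of instances with $t\le\tau(m)$ for any fixed function $\tau$ with $\tau(m)=o(m)$, the asymptotic competitive ratio is at most $1.693\cdot 2<3.39$ with HARMONIC$_{12}$ and at most $4$ with NEXT-FIT. Here the asymptotic competitive ratio is $\limsup_{n\to\infty}\sup\{\mathrm{ALG}(\sigma)/B(\sigma) : B(\sigma)=n\}$, where $\sigma$ runs over the instances of the class, $\mathrm{ALG}(\sigma)$ is the number of colors that the algorithm uses, and the benchmark $B(\sigma)$ is the minimum number of colors of a proper coloring; the same bounds hold with $B=m$. -/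

import Mathlib

open Filter Asymptotics
open scoped ENNReal

namespace OnlineColoring

/-- An edge of a weighted undirected (loopless) multigraph on `V`: an unordered pair of distinct
end vertices together with a weight in `[0,1]`. -/
structure Edge (V : Type*) where
  ends : Sym2 V
  weight : ℝ
  not_loop : ¬ ends.IsDiag
  weight_nonneg : 0 ≤ weight
  weight_le_one : weight ≤ 1

/-! An edge-weighted multigraph with online edge arrivals is a list `σ : List (Edge V)`, in the
order of arrival; parallel edges are different entries of the list. A coloring of (part of) it is a
list of pairs (edge, color), in the same order. -/

section Parameters

variable {V : Type*}

/-- The bin-packing optimum of the item sizes `ws`: the least number of unit-sized bins into which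
all items can be packed. -/
noncomputable def binPackingOpt (ws : List ℝ) : ℕ :=
  sInf {k : ℕ | ∃ f : Fin ws.length → Fin k,
    ∀ j : Fin k, ∑ i with f i = j, ws.get i ≤ 1}

open Classical in
/-- The weights of the edges incident to `v`. -/
noncomputable def incidentWeights (σ : List (Edge V)) (v : V) : List ℝ :=
  (σ.filter (fun e => v ∈ e.ends)).map Edge.weight

/-- `m`: the maximum over all vertices of the bin-packing optimum of the incident edge weights.
(The family is bounded by `σ.length`, so the supremum is a maximum; it is `0` if there are no
vertices.) -/
noncomputable def maxBins (σ : List (Edge V)) : ℕ :=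
  ⨆ v : V, binPackingOpt (incidentWeights σ v)

/-- The neighbors of `v`. -/
def neighbors (σ : List (Edge V)) (v : V) : Set V :=
  {u | ∃ e ∈ σ, e.ends = s(v, u)}

/-- `t`: the maximum number of neighbors of a vertex. (All but finitely many vertices have no
neighbors, and each has finitely many, so the supremum is a maximum.) -/
noncomputable def maxNeighbors (σ : List (Edge V)) : ℕ :=
  ⨆ v : V, (neighbors σ v).ncard

open Classical in
/-- The total weight of the edges incident to `v` which have color `c`. -/
noncomputable def load (L : List (Edge V × ℕ)) (v : V) (c : ℕ) : ℝ :=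
  ((L.filter (fun p => v ∈ p.1.ends ∧ p.2 = c)).map (fun p => p.1.weight)).sum

/-- `L` colors every edge of `σ` with a color from the palette `{1, …, k}`, and is a proper
weighted coloring: at every vertex, the edges of any one color have total weight at most `1`. -/
def IsProperColoring (σ : List (Edge V)) (L : List (Edge V × ℕ)) (k : ℕ) : Prop :=
  L.map Prod.fst = σ ∧ (∀ p ∈ L, 1 ≤ p.2 ∧ p.2 ≤ k) ∧ ∀ (v : V) (c : ℕ), load L v c ≤ 1

/-- The offline optimum: the least number of colors of a proper weighted coloring of `σ`. -/
noncomputable def optColors (σ : List (Edge V)) : ℕ :=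
  sInf {k : ℕ | ∃ L, IsProperColoring σ L k}

/-- The number of different colors used by a coloring. -/
def numColors (L : List (Edge V × ℕ)) : ℕ := (L.map Prod.snd).toFinset.card

end Parameters

section Algorithm

variable {V κ : Type*}

/-- The memory of the online algorithm: the edges that have arrived with their colors, the current
open color of each type (in `κ`) between each pair of vertices (if there is one), and the set of
closed colors of each pair of vertices. -/
structure State (V κ : Type*) where
  colored : List (Edge V × ℕ)
  openColor : Sym2 V → κ → Option ℕ
  closedColors : Sym2 V → Set ℕ

/-- Before the first arrival. -/
def State.init : State V κ where
  colored := []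
  openColor := fun _ _ => none
  closedColors := fun _ => ∅

/-- The color `c` is empty for `v`: it is neither open nor closed between `v` and a neighbor. -/
def State.IsEmptyFor (s : State V κ) (v : V) (c : ℕ) : Prop :=
  ∀ p : Sym2 V, v ∈ p → (∀ i, s.openColor p i ≠ some c) ∧ c ∉ s.closedColors p

/-- The least color in `{1, 2, …}` that is empty for both vertices of the pair `p`. -/
noncomputable def State.leastEmpty (s : State V κ) (p : Sym2 V) : ℕ :=
  sInf {c : ℕ | 1 ≤ c ∧ ∀ v ∈ p, s.IsEmptyFor v c}

/-- The edge `e` can be colored with `c` without violating properness. -/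
def State.Fits (s : State V κ) (e : Edge V) (c : ℕ) : Prop :=
  ∀ v ∈ e.ends, load s.colored v c + e.weight ≤ 1

open Classical in
/-- Color the arriving edge `e` with the least empty color, which becomes the open color of type
`i` between the ends of `e`. -/
noncomputable def State.colorFresh (s : State V κ) (e : Edge V) (i : κ) : State V κ where
  colored := s.colored ++ [(e, s.leastEmpty e.ends)]
  openColor := Function.update s.openColor e.ends
    (Function.update (s.openColor e.ends) i (some (s.leastEmpty e.ends)))
  closedColors := s.closedColors

open Classical in
/-- Close the color `c` between the two vertices of the pair `p`. (In `State.step` the entry of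
`openColor` that holds `c` is overwritten at once by the new open color.) -/
noncomputable def State.close (s : State V κ) (p : Sym2 V) (c : ℕ) : State V κ :=
  { s with closedColors := Function.update s.closedColors p (insert c (s.closedColors p)) }

open Classical in
/-- The arrival of the edge `e`, when edges of weight `w` have type `typ w`: if there is no open
color of the type of `e` between the ends of `e`, open a fresh one and use it; if there is one and
`e` can be colored with it, use it; otherwise close it, open a fresh one and use that. -/
noncomputable def State.step (typ : ℝ → κ) (s : State V κ) (e : Edge V) : State V κ :=
  match s.openColor e.ends (typ e.weight) with
  | none => s.colorFresh e (typ e.weight)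
  | some c =>
    if s.Fits e c then { s with colored := s.colored ++ [(e, c)] }
    else (s.close e.ends c).colorFresh e (typ e.weight)

/-- The coloring that results when the edges of `σ` arrive one by one. -/
noncomputable def onlineColoring (typ : ℝ → κ) (σ : List (Edge V)) : List (Edge V × ℕ) :=
  (σ.foldl (State.step typ) State.init).colored

/-- Coloring with NEXT-FIT for each pair of neighbors: all edges have the same type. -/
noncomputable def nextFitColoring (σ : List (Edge V)) : List (Edge V × ℕ) :=
  onlineColoring (fun _ => ()) σ

/-- The HARMONIC type of an item of size `w ∈ [0,1]`: type `i` is the interval `(1/(i+1), 1/i]` for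
`1 ≤ i < M`, and type `M` is `[0, 1/M]`. -/
noncomputable def harmonicType (M : ℕ) (w : ℝ) : ℕ :=
  if w ≤ 1 / (M : ℝ) then M else ⌊1 / w⌋₊

/-- Coloring with HARMONIC with `M` types for each pair of neighbors. -/
noncomputable def harmonicColoring (M : ℕ) (σ : List (Edge V)) : List (Edge V × ℕ) :=
  onlineColoring (harmonicType M) σ

end Algorithm

/-- The asymptotic competitive ratio, on a class `S` of instances, of an algorithm with cost `alg`
against the benchmark `opt`:
the upper limit, as `n → ∞`, of the supremum of `alg σ / opt σ` over `σ ∈ S` with `opt σ = n`. -/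
noncomputable def asymptoticRatio {I : Type*} (S : Set I) (alg opt : I → ℕ) : ℝ≥0∞ :=
  limsup (fun n : ℕ => ⨆ σ ∈ {σ ∈ S | opt σ = n}, (alg σ : ℝ≥0∞) / (opt σ : ℝ≥0∞)) atTop

/-- The instances on the vertex set `V` with `t ≤ τ(m)`. -/
def instancesWithNeighborBound (V : Type*) (τ : ℕ → ℝ) : Set (List (Edge V)) :=
  {σ | (maxNeighbors σ : ℝ) ≤ τ (maxBins σ)}

end OnlineColoring

namespace OnlineColoring

/-! The proof bounds, for each vertex `v`, the number of colors that are nonempty at `v`. Since a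
fresh color is the least one empty at both ends, every color up to that of an edge `uv` is nonempty
at `u` or at `v`; hence no color exceeds the sum of the two counts
(`State.Sound.le_ncard_add_ncard`).

At `v`, each neighbor accounts for at most one open color per type. The closed colors are paid for
by a potential argument (`State.Paid`): for suitable weight functions `g` and `h`, the number of
closed colors of a pair plus the `h`-weight in its open colors never exceeds the `g`-weight of its
edges. If a unit bin holds `g`-weight at most `ρ`, an optimal packing of the edges at `v` bounds
their `g`-weight by `ρ * m`. So at most `ρ * m + |T| * t` colors are nonempty at `v`, and twice this
bounds every color (`isProperColoring_onlineColoring`).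

NEXT-FIT takes `g w = 2 * w`, `h w = w` and `ρ = 2`; HARMONIC takes the classical harmonic weight
for both and `ρ = 1.693`. For the ratio, the color classes of a proper coloring pack the edges at
each vertex into bins, so `m` is at most the optimum; and `t = o(m)` is absorbed by an arbitrarily
small slack. -/

variable {V κ : Type*}

/-! ### Weight sums over colored edge lists -/

open Classical in
/-- The sum of `f` over the weights of the edges between the vertices of `p`. -/
noncomputable def pairSum (f : ℝ → ℝ) (L : List (Edge V × ℕ)) (p : Sym2 V) : ℝ :=
  ((L.filter (fun x => x.1.ends = p)).map (fun x => f x.1.weight)).sum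

open Classical in
/-- The sum of `f` over the weights of the edges of color `c` between the vertices of `p`. -/
noncomputable def pairColorSum (f : ℝ → ℝ) (L : List (Edge V × ℕ)) (p : Sym2 V) (c : ℕ) : ℝ :=
  ((L.filter (fun x => x.1.ends = p ∧ x.2 = c)).map (fun x => f x.1.weight)).sum

open Classical in
theorem load_append (L : List (Edge V × ℕ)) (e : Edge V) (d : ℕ) (v : V) (c : ℕ) :
    load (L ++ [(e, d)]) v c = load L v c + if v ∈ e.ends ∧ d = c then e.weight else 0 := by
  unfold load
  rw [List.filter_append, List.map_append, List.sum_append]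
  by_cases h : v ∈ e.ends ∧ d = c <;> simp [h]

open Classical in
theorem pairSum_append (f : ℝ → ℝ) (L : List (Edge V × ℕ)) (e : Edge V) (d : ℕ) (p : Sym2 V) :
    pairSum f (L ++ [(e, d)]) p = pairSum f L p + if e.ends = p then f e.weight else 0 := by
  unfold pairSum
  rw [List.filter_append, List.map_append, List.sum_append]
  by_cases h : e.ends = p <;> simp [h]

open Classical in
theorem pairColorSum_append (f : ℝ → ℝ) (L : List (Edge V × ℕ)) (e : Edge V) (d : ℕ)
    (p : Sym2 V) (c : ℕ) :
    pairColorSum f (L ++ [(e, d)]) p c =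
      pairColorSum f L p c + if e.ends = p ∧ d = c then f e.weight else 0 := by
  unfold pairColorSum
  rw [List.filter_append, List.map_append, List.sum_append]
  by_cases h : e.ends = p ∧ d = c <;> simp [h]

theorem pairColorSum_nonneg {f : ℝ → ℝ} (hf : ∀ w, 0 ≤ w → 0 ≤ f w) (L : List (Edge V × ℕ))
    (p : Sym2 V) (c : ℕ) : 0 ≤ pairColorSum f L p c := by
  refine List.sum_nonneg fun x hx => ?_
  obtain ⟨y, -, rfl⟩ := List.mem_map.1 hx
  exact hf _ y.1.weight_nonneg

theorem load_eq_zero {L : List (Edge V × ℕ)} {v : V} {c : ℕ}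
    (h : ∀ x ∈ L, v ∈ x.1.ends → x.2 ≠ c) : load L v c = 0 := by
  unfold load
  rw [List.filter_eq_nil_iff.2]
  · simp
  · intro x hx
    simpa using h x hx

theorem pairColorSum_eq_zero {f : ℝ → ℝ} {L : List (Edge V × ℕ)} {p : Sym2 V} {c : ℕ}
    (h : ∀ x ∈ L, x.1.ends = p → x.2 ≠ c) : pairColorSum f L p c = 0 := by
  unfold pairColorSum
  rw [List.filter_eq_nil_iff.2]
  · simp
  · intro x hx
    simpa using h x hx

/-! ### Structural invariants of the algorithm -/

theorem State.not_isEmptyFor_iff {s : State V κ} {v : V} {c : ℕ} :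
    ¬ s.IsEmptyFor v c ↔ ∃ p : Sym2 V, v ∈ p ∧ ((∃ i, s.openColor p i = some c) ∨
      c ∈ s.closedColors p) := by
  unfold State.IsEmptyFor
  push Not
  refine exists_congr fun p => and_congr_right fun _ => ?_
  by_cases hc : c ∈ s.closedColors p <;> simp [hc]

/-- The structural invariants of the online algorithm with type function `typ`. -/
structure State.Sound (typ : ℝ → κ) (s : State V κ) : Prop where
  eq_of_open : ∀ {p i c}, s.openColor p i = some c → ∀ {x}, x ∈ s.colored → x.2 = c →
    ∀ {v}, v ∈ p → v ∈ x.1.ends → x.1.ends = p ∧ typ x.1.weight = i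
  exists_of_open : ∀ {p i c}, s.openColor p i = some c →
    ∃ x ∈ s.colored, x.1.ends = p ∧ typ x.1.weight = i ∧ x.2 = c
  exists_of_closed : ∀ {p c}, c ∈ s.closedColors p → ∃ x ∈ s.colored, x.1.ends = p ∧ x.2 = c
  not_empty : ∀ {x}, x ∈ s.colored → ∀ {v}, v ∈ x.1.ends → ¬ s.IsEmptyFor v x.2
  pos : ∀ {x}, x ∈ s.colored → 1 ≤ x.2
  -- The lasting trace of the least choice: colors never become empty again, so this survives later
  -- arrivals.
  below : ∀ {x}, x ∈ s.colored → ∀ {c}, 1 ≤ c → c ≤ x.2 → ∃ v ∈ x.1.ends, ¬ s.IsEmptyFor v c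
  load_le : ∀ v c, load s.colored v c ≤ 1

namespace State.Sound

variable {typ : ℝ → κ} {s : State V κ}

theorem init : (State.init : State V κ).Sound typ := by
  constructor <;> simp [State.init, load]

theorem finite_used (hs : s.Sound typ) (v : V) : {c | ¬ s.IsEmptyFor v c}.Finite := by
  refine (List.finite_toSet (s.colored.map Prod.snd)).subset fun c hc => ?_
  obtain ⟨p, -, ⟨i, h⟩ | h⟩ := State.not_isEmptyFor_iff.1 hc
  · obtain ⟨x, hx, -, -, rfl⟩ := hs.exists_of_open h
    exact List.mem_map_of_mem hx
  · obtain ⟨x, hx, -, rfl⟩ := hs.exists_of_closed h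
    exact List.mem_map_of_mem hx

theorem finite_closed (hs : s.Sound typ) (p : Sym2 V) : (s.closedColors p).Finite := by
  refine (List.finite_toSet (s.colored.map Prod.snd)).subset fun c hc => ?_
  obtain ⟨x, hx, -, rfl⟩ := hs.exists_of_closed hc
  exact List.mem_map_of_mem hx

/-- An open color carries an edge, and the type of that edge decides the type. Hence a newly
assigned edge affects only one open sum. -/
theorem open_injective (hs : s.Sound typ) {p : Sym2 V} {i j : κ} {c : ℕ}
    (hi : s.openColor p i = some c) (hj : s.openColor p j = some c) : i = j := by
  obtain ⟨x, hx, hp, ht, hc⟩ := hs.exists_of_open hi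
  obtain ⟨v, hv⟩ : ∃ v, v ∈ p := ⟨_, p.out_fst_mem⟩
  exact ht.symm.trans (hs.eq_of_open hj hx hc hv (hp ▸ hv)).2

theorem leastEmpty_spec (hs : s.Sound typ) (p : Sym2 V) :
    1 ≤ s.leastEmpty p ∧ ∀ v ∈ p, s.IsEmptyFor v (s.leastEmpty p) := by
  have : {c : ℕ | 1 ≤ c ∧ ∀ v ∈ p, s.IsEmptyFor v c}.Nonempty := by
    induction p with | _ a b
    -- Only finitely many colors are used at either end; `0` is excluded as well because colors
    -- start at `1`.
    obtain ⟨c, hc⟩ := (((hs.finite_used a).union (hs.finite_used b)).insert 0).exists_notMem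
    simp only [Set.mem_insert_iff, Set.mem_union, Set.mem_ofPred_eq, not_or, not_not] at hc
    refine ⟨c, Nat.one_le_iff_ne_zero.2 hc.1, fun v hv => ?_⟩
    rcases Sym2.mem_iff.1 hv with rfl | rfl
    exacts [hc.2.1, hc.2.2]
  exact Nat.sInf_mem this

theorem exists_not_isEmptyFor {p : Sym2 V} {c : ℕ} (h1 : 1 ≤ c) (hc : c < s.leastEmpty p) :
    ∃ v ∈ p, ¬ s.IsEmptyFor v c := by
  by_contra! h
  exact Nat.notMem_of_lt_sInf hc ⟨h1, h⟩

/-- No other pair uses an open color at either end. The two ends therefore have equal load, and an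
edge that does not fit overfills the color with edges of its own pair. -/
theorem load_eq (hs : s.Sound typ) {p : Sym2 V} {i : κ} {c : ℕ} (h : s.openColor p i = some c)
    {v : V} (hv : v ∈ p) : load s.colored v c = pairColorSum id s.colored p c := by
  unfold load pairColorSum
  congr 2
  refine List.filter_congr fun x hx => ?_
  simp only [decide_eq_decide]
  exact ⟨fun hx' => ⟨(hs.eq_of_open h hx hx'.2 hv hx'.1).1, hx'.2⟩, fun hx' => ⟨hx'.1 ▸ hv, hx'.2⟩⟩

/-- The entry of `openColor` is kept, so the color is both open and closed for a moment, and
nonempty colors stay nonempty. -/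
theorem close (hs : s.Sound typ) {p : Sym2 V} {i : κ} {c : ℕ} (h : s.openColor p i = some c) :
    (s.close p c).Sound typ := by
  classical
  have hne : ∀ {v d}, ¬ s.IsEmptyFor v d → ¬ (s.close p c).IsEmptyFor v d := by
    intro v d hd
    rw [State.not_isEmptyFor_iff] at hd ⊢
    obtain ⟨q, hq, hd⟩ := hd
    refine ⟨q, hq, hd.imp_right fun hd => ?_⟩
    by_cases hqp : q = p
    · subst hqp
      simp [State.close, hd]
    · simpa [State.close, hqp] using hd
  refine ⟨hs.eq_of_open, hs.exists_of_open, fun {q d} hd => ?_, fun hx _ hv => hne (hs.not_empty hx hv),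
    hs.pos, fun hx _ h1 h2 => (hs.below hx h1 h2).imp fun v hv => ⟨hv.1, hne hv.2⟩, hs.load_le⟩
  by_cases hqp : q = p
  · subst hqp
    simp only [State.close, Function.update_self, Set.mem_insert_iff] at hd
    rcases hd with rfl | hd
    · obtain ⟨x, hx, h1, -, h2⟩ := hs.exists_of_open h
      exact ⟨x, hx, h1, h2⟩
    · exact hs.exists_of_closed hd
  · simp only [State.close, Function.update_of_ne hqp] at hd
    exact hs.exists_of_closed hd

theorem assign (hs : s.Sound typ) {e : Edge V} {c : ℕ}
    (h : s.openColor e.ends (typ e.weight) = some c) (hfit : s.Fits e c) :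
    ({ s with colored := s.colored ++ [(e, c)] } : State V κ).Sound typ := by
  obtain ⟨y, hy, hy1, hy2, hy3⟩ := hs.exists_of_open h
  constructor
  · intro p i d hd x hx hxd v hv hvx
    rcases List.mem_append.1 hx with hx | hx
    · exact hs.eq_of_open hd hx hxd hv hvx
    · obtain rfl := List.mem_singleton.1 hx
      have := hs.eq_of_open hd hy (hy3.trans hxd) hv (hy1 ▸ hvx)
      rwa [hy1, hy2] at this
  · intro p i d hd
    obtain ⟨x, hx, hx'⟩ := hs.exists_of_open hd
    exact ⟨x, List.mem_append_left _ hx, hx'⟩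
  · intro p d hd
    obtain ⟨x, hx, hx'⟩ := hs.exists_of_closed hd
    exact ⟨x, List.mem_append_left _ hx, hx'⟩
  · intro x hx v hv
    rcases List.mem_append.1 hx with hx | hx
    · exact hs.not_empty hx hv
    · obtain rfl := List.mem_singleton.1 hx
      exact hy3 ▸ hs.not_empty hy (hy1 ▸ hv)
  · intro x hx
    rcases List.mem_append.1 hx with hx | hx
    · exact hs.pos hx
    · obtain rfl := List.mem_singleton.1 hx
      exact (hs.pos hy).trans_eq hy3
  · intro x hx d h1 h2
    rcases List.mem_append.1 hx with hx | hx
    · exact hs.below hx h1 h2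
    · obtain rfl := List.mem_singleton.1 hx
      exact hy1 ▸ hs.below hy h1 (hy3 ▸ h2)
  · intro v d
    simp only [load_append]
    split_ifs with hv
    · rw [← hv.2]
      exact hfit v hv.1
    · simpa using hs.load_le v d

/-- Overwriting the entry of `openColor` could make a color empty again; `h` rules this out, as the
overwritten color is already recorded as closed. -/
theorem colorFresh (hs : s.Sound typ) {e : Edge V}
    (h : ∀ c, s.openColor e.ends (typ e.weight) = some c → c ∈ s.closedColors e.ends) :
    (s.colorFresh e (typ e.weight)).Sound typ := by
  classical
  obtain ⟨hpos, hempty⟩ := hs.leastEmpty_spec e.ends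
  set c₀ := s.leastEmpty e.ends with hc₀
  have hcol : (s.colorFresh e (typ e.weight)).colored = s.colored ++ [(e, c₀)] := rfl
  have hself : (s.colorFresh e (typ e.weight)).openColor e.ends (typ e.weight) = some c₀ := by
    simp [State.colorFresh, ← hc₀]
  have hother : ∀ {p i}, ¬ (p = e.ends ∧ i = typ e.weight) →
      (s.colorFresh e (typ e.weight)).openColor p i = s.openColor p i := by
    intro p i hpi
    by_cases hp : p = e.ends
    · subst hp
      simp [State.colorFresh, Function.update_of_ne (fun hi => hpi ⟨rfl, hi⟩)]
    · simp [State.colorFresh, hp]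
  have hnew : ∀ v ∈ e.ends, ¬ (s.colorFresh e (typ e.weight)).IsEmptyFor v c₀ := fun v hv =>
    State.not_isEmptyFor_iff.2 ⟨_, hv, .inl ⟨_, hself⟩⟩
  have hne : ∀ {v d}, ¬ s.IsEmptyFor v d → ¬ (s.colorFresh e (typ e.weight)).IsEmptyFor v d := by
    intro v d hd
    rw [State.not_isEmptyFor_iff] at hd ⊢
    obtain ⟨q, hq, hd⟩ := hd
    refine ⟨q, hq, ?_⟩
    rcases hd with ⟨i, hi⟩ | hd
    · by_cases hqi : q = e.ends ∧ i = typ e.weight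
      · obtain ⟨rfl, rfl⟩ := hqi
        exact .inr (h d hi)
      · exact .inl ⟨i, (hother hqi).trans hi⟩
    · exact .inr hd
  constructor
  · intro p i d hd x hx hxd v hv hvx
    by_cases hpi : p = e.ends ∧ i = typ e.weight
    · obtain ⟨rfl, rfl⟩ := hpi
      obtain rfl : c₀ = d := Option.some.inj (hself.symm.trans hd)
      rcases List.mem_append.1 hx with hx | hx
      · exact absurd (hempty v hv) (hxd ▸ hs.not_empty hx hvx)
      · obtain rfl := List.mem_singleton.1 hx
        exact ⟨rfl, rfl⟩
    · rw [hother hpi] at hd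
      rcases List.mem_append.1 hx with hx | hx
      · exact hs.eq_of_open hd hx hxd hv hvx
      · obtain rfl := List.mem_singleton.1 hx
        obtain rfl : c₀ = d := hxd
        exact absurd hd ((hempty v hvx p hv).1 i)
  · intro p i d hd
    by_cases hpi : p = e.ends ∧ i = typ e.weight
    · obtain ⟨rfl, rfl⟩ := hpi
      obtain rfl : c₀ = d := Option.some.inj (hself.symm.trans hd)
      exact ⟨(e, c₀), by simp [hcol], rfl, rfl, rfl⟩
    · rw [hother hpi] at hd
      obtain ⟨x, hx, hx'⟩ := hs.exists_of_open hd
      exact ⟨x, List.mem_append_left _ hx, hx'⟩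
  · intro p d hd
    obtain ⟨x, hx, hx'⟩ := hs.exists_of_closed hd
    exact ⟨x, List.mem_append_left _ hx, hx'⟩
  · intro x hx v hv
    rcases List.mem_append.1 hx with hx | hx
    · exact hne (hs.not_empty hx hv)
    · obtain rfl := List.mem_singleton.1 hx
      exact hnew v hv
  · intro x hx
    rcases List.mem_append.1 hx with hx | hx
    · exact hs.pos hx
    · obtain rfl := List.mem_singleton.1 hx
      exact hpos
  · intro x hx d h1 h2
    rcases List.mem_append.1 hx with hx | hx
    · exact (hs.below hx h1 h2).imp fun v hv => ⟨hv.1, hne hv.2⟩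
    · obtain rfl := List.mem_singleton.1 hx
      rcases h2.lt_or_eq with h2 | rfl
      · exact (exists_not_isEmptyFor h1 h2).imp fun v hv => ⟨hv.1, hne hv.2⟩
      · exact ⟨_, e.ends.out_fst_mem, hnew _ e.ends.out_fst_mem⟩
  · intro v d
    rw [hcol, load_append]
    split_ifs with hv
    · obtain ⟨hv, rfl⟩ := hv
      rw [load_eq_zero, zero_add]
      · exact e.weight_le_one
      · exact fun x hx hvx hxc => hs.not_empty hx hvx (hxc ▸ hempty v hv)
    · simpa using hs.load_le v d

theorem step (hs : s.Sound typ) (e : Edge V) : (s.step typ e).Sound typ := by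
  unfold State.step
  split
  · rename_i h
    exact hs.colorFresh (by simp [h])
  · rename_i c h
    split_ifs with hfit
    · exact hs.assign h hfit
    · refine (hs.close h).colorFresh fun d hd => ?_
      obtain rfl : c = d := Option.some.inj (h.symm.trans hd)
      simp [State.close]

end State.Sound

/-! ### Amortized payment for closed colors -/

/-- The `h`-sum of the open color of type `i` between the vertices of `p`, if there is one. -/
noncomputable def State.openSum (h : ℝ → ℝ) (s : State V κ) (p : Sym2 V) (i : κ) : ℝ :=
  (s.openColor p i).elim 0 (pairColorSum h s.colored p)

/-- Weight functions `g` and `h` for which the edges that are assigned to a color before it is closed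
pay for this color. -/
structure IsCharging (typ : ℝ → κ) (T : Finset κ) (g h : ℝ → ℝ) : Prop where
  typ_mem : ∀ w, 0 ≤ w → w ≤ 1 → typ w ∈ T
  nonneg : ∀ w, 0 ≤ w → 0 ≤ h w
  le : ∀ w, 0 ≤ w → h w ≤ g w
  -- `ws` is the content of the open color and `x` the edge that overfills it. Closing adds `1` to
  -- the closed count and replaces the open sum of `ws` by `h x`, while the budget grows by `g x`.
  closing : ∀ (ws : List ℝ) (x : ℝ), (∀ w ∈ ws, 0 ≤ w ∧ w ≤ 1 ∧ typ w = typ x) → 0 ≤ x → x ≤ 1 →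
    1 < ws.sum + x → 1 + h x ≤ (ws.map h).sum + g x

/-- The closed colors of each pair of vertices are paid for. -/
def State.Paid (T : Finset κ) (g h : ℝ → ℝ) (s : State V κ) : Prop :=
  ∀ p, ((s.closedColors p).ncard : ℝ) + ∑ i ∈ T, s.openSum h p i ≤ pairSum g s.colored p

section Paid

variable {typ : ℝ → κ} {T : Finset κ} {g h : ℝ → ℝ} {s : State V κ}

theorem State.Paid.init : (State.init : State V κ).Paid T g h := by
  intro p
  simp [State.init, State.openSum, pairSum]

theorem State.Paid.assign (hp : s.Paid T g h) (hc : IsCharging typ T g h) (hs : s.Sound typ)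
    {e : Edge V} {c : ℕ} (ho : s.openColor e.ends (typ e.weight) = some c) :
    ({ s with colored := s.colored ++ [(e, c)] } : State V κ).Paid T g h := by
  classical
  intro p
  have key : ∀ i, ({ s with colored := s.colored ++ [(e, c)] } : State V κ).openSum h p i
      = s.openSum h p i + if i = typ e.weight then (if e.ends = p then h e.weight else 0) else 0 := by
    intro i
    unfold State.openSum
    cases hi : s.openColor p i with
    | none =>
      have : ¬ (i = typ e.weight ∧ e.ends = p) := by
        rintro ⟨rfl, rfl⟩
        simp [ho] at hi
      simp only [Option.elim_none, zero_add]
      split_ifs <;> simp_all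
    | some d =>
      simp only [Option.elim_some, pairColorSum_append, add_right_inj, ← ite_and]
      refine if_congr ⟨?_, ?_⟩ rfl rfl
      · rintro ⟨rfl, rfl⟩
        exact ⟨hs.open_injective hi ho, rfl⟩
      · rintro ⟨rfl, rfl⟩
        exact ⟨rfl, Option.some.inj (ho.symm.trans hi)⟩
  have hT := hc.typ_mem _ e.weight_nonneg e.weight_le_one
  simp only [key, Finset.sum_add_distrib, Finset.sum_ite_eq', hT, if_true, pairSum_append]
  have h1 := hp p
  have h2 := hc.le _ e.weight_nonneg
  split_ifs <;> linarith

/-- Treats both ways to a fresh color: `s'` stands for `s` itself or for `s` after closing. `hends`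
is the balance at the pair of `e`, where the new color starts with open sum `h e.weight`. -/
theorem State.Paid.colorFresh (hp : s.Paid T g h) (hc : IsCharging typ T g h)
    {e : Edge V} {s' : State V κ} (hs' : s'.Sound typ) (hcol : s'.colored = s.colored)
    (hopen : s'.openColor = s.openColor)
    (hclosed : ∀ p, p ≠ e.ends → s'.closedColors p = s.closedColors p)
    (hends : ((s'.closedColors e.ends).ncard : ℝ) + h e.weight ≤ (s.closedColors e.ends).ncard +
      s.openSum h e.ends (typ e.weight) + g e.weight) :
    (s'.colorFresh e (typ e.weight)).Paid T g h := by
  classical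
  obtain ⟨-, hempty⟩ := hs'.leastEmpty_spec e.ends
  intro p
  have hsum : pairSum g (s'.colorFresh e (typ e.weight)).colored p = _ :=
    pairSum_append g s'.colored e _ p
  rw [hsum, hcol]
  have hcl : (s'.colorFresh e (typ e.weight)).closedColors = s'.closedColors := rfl
  rw [hcl]
  by_cases hpe : p = e.ends
  · subst hpe
    have key : ∀ i, i ≠ typ e.weight →
        (s'.colorFresh e (typ e.weight)).openSum h e.ends i = s.openSum h e.ends i := by
      intro i hi
      simp only [State.openSum, State.colorFresh, Function.update_self, Function.update_of_ne hi,
        hopen, hcol]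
      cases hd : s.openColor e.ends i with
      | none => rfl
      | some d =>
        have : s'.leastEmpty e.ends ≠ d := by
          rintro rfl
          exact (hempty _ e.ends.out_fst_mem _ e.ends.out_fst_mem).1 i (hopen ▸ hd)
        simp [pairColorSum_append, this]
    have key' : (s'.colorFresh e (typ e.weight)).openSum h e.ends (typ e.weight) = h e.weight := by
      simp only [State.openSum, State.colorFresh, Function.update_self, Option.elim_some,
        pairColorSum_append, and_self, if_true]
      rw [pairColorSum_eq_zero, zero_add]
      intro x hx hxe hxc
      have hv : e.ends.out.1 ∈ x.1.ends := hxe ▸ e.ends.out_fst_mem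
      exact hs'.not_empty hx hv (hxc ▸ hempty _ e.ends.out_fst_mem)
    have hT := hc.typ_mem _ e.weight_nonneg e.weight_le_one
    have h1 := hp e.ends
    rw [← Finset.add_sum_erase _ _ hT] at h1 ⊢
    rw [key', Finset.sum_congr rfl fun i hi => key i (Finset.ne_of_mem_erase hi), if_pos rfl]
    linarith
  · have key : ∀ i, (s'.colorFresh e (typ e.weight)).openSum h p i = s.openSum h p i := by
      intro i
      simp only [State.openSum, State.colorFresh, Function.update_of_ne hpe, hopen, hcol]
      cases s.openColor p i with
      | none => rfl
      | some d => simp [pairColorSum_append, Ne.symm hpe]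
    simp only [key, hclosed p hpe, if_neg (Ne.symm hpe), add_zero]
    exact hp p

theorem State.Paid.step (hp : s.Paid T g h) (hc : IsCharging typ T g h) (hs : s.Sound typ)
    (e : Edge V) : (s.step typ e).Paid T g h := by
  classical
  unfold State.step
  split
  · rename_i ho
    refine hp.colorFresh hc hs rfl rfl (fun _ _ => rfl) ?_
    have := hc.le _ e.weight_nonneg
    simp only [State.openSum, ho, Option.elim_none]
    linarith
  · rename_i c ho
    split_ifs with hfit
    · exact hp.assign hc hs ho
    · refine hp.colorFresh hc (hs.close ho) rfl rfl (fun p hpe => ?_) ?_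
      · simp [State.close, hpe]
      · have h1 : ((s.close e.ends c).closedColors e.ends).ncard
            ≤ (s.closedColors e.ends).ncard + 1 := by
          simpa [State.close] using Set.ncard_insert_le c (s.closedColors e.ends)
        have h1' : (((s.close e.ends c).closedColors e.ends).ncard : ℝ)
            ≤ (s.closedColors e.ends).ncard + 1 := by exact_mod_cast h1
        simp only [State.openSum, ho, Option.elim_some]
        have h2 : 1 + h e.weight ≤ pairColorSum h s.colored e.ends c + g e.weight := by
          unfold State.Fits at hfit
          push Not at hfit
          obtain ⟨v, hv, hlt⟩ := hfit
          rw [hs.load_eq ho hv] at hlt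
          have := hc.closing ((s.colored.filter (fun x : Edge V × ℕ => x.1.ends = e.ends ∧ x.2 = c)).map
            (fun x : Edge V × ℕ => x.1.weight)) e.weight ?_ e.weight_nonneg e.weight_le_one hlt
          · rwa [List.map_map] at this
          · intro w hw
            obtain ⟨x, hx, rfl⟩ := List.mem_map.1 hw
            obtain ⟨hx, hx'⟩ := List.mem_filter.1 hx
            obtain ⟨hx1, hx2⟩ := of_decide_eq_true hx'
            exact ⟨x.1.weight_nonneg, x.1.weight_le_one,
              (hs.eq_of_open ho hx hx2 hv (hx1 ▸ hv)).2⟩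
        linarith

end Paid

/-! ### The invariants along the whole arrival sequence -/

theorem sound_foldl (typ : ℝ → κ) (σ : List (Edge V)) :
    (σ.foldl (State.step typ) State.init).Sound typ :=
  List.foldlRecOn σ _ State.Sound.init fun _ hs e _ => hs.step e

theorem paid_foldl {typ : ℝ → κ} {T : Finset κ} {g h : ℝ → ℝ} (hc : IsCharging typ T g h)
    (σ : List (Edge V)) : (σ.foldl (State.step typ) State.init).Paid T g h :=
  (List.foldlRecOn (motive := fun s : State V κ => s.Sound typ ∧ s.Paid T g h) σ _
    ⟨State.Sound.init, State.Paid.init⟩ fun _ hs e _ => ⟨hs.1.step e, hs.2.step hc hs.1 e⟩).2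

theorem State.map_fst_step (typ : ℝ → κ) (s : State V κ) (e : Edge V) :
    (s.step typ e).colored.map Prod.fst = s.colored.map Prod.fst ++ [e] := by
  unfold State.step
  split
  · simp [State.colorFresh]
  · split_ifs <;> simp [State.colorFresh, State.close]

theorem map_fst_onlineColoring (typ : ℝ → κ) (σ : List (Edge V)) :
    (onlineColoring typ σ).map Prod.fst = σ := by
  unfold onlineColoring
  induction σ using List.reverseRecOn with
  | nil => rfl
  | append_singleton σ e ih => rw [List.foldl_append]; simp [State.map_fst_step, ih]

/-! ### Bin packing, neighbors and the offline optimum -/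

section Parameters

theorem mem_incidentWeights {σ : List (Edge V)} {v : V} {w : ℝ} (hw : w ∈ incidentWeights σ v) :
    0 ≤ w ∧ w ≤ 1 := by
  obtain ⟨e, -, rfl⟩ := List.mem_map.1 hw
  exact ⟨e.weight_nonneg, e.weight_le_one⟩

open Classical in
theorem incidentWeights_map_fst (L : List (Edge V × ℕ)) (v : V) :
    incidentWeights (L.map Prod.fst) v =
      (L.filter (fun x => v ∈ x.1.ends)).map (fun x => x.1.weight) := by
  unfold incidentWeights
  rw [List.filter_map, List.map_map]
  rfl

theorem exists_packing (ws : List ℝ) (h : ∀ w ∈ ws, w ≤ 1) :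
    ∃ f : Fin ws.length → Fin ws.length, ∀ j, ∑ i with f i = j, ws.get i ≤ 1 := by
  refine ⟨id, fun j => ?_⟩
  simp only [id, Finset.sum_filter, Finset.sum_ite_eq', Finset.mem_univ, if_true]
  exact h _ (List.get_mem _ _)

theorem binPackingOpt_le_length (ws : List ℝ) (h : ∀ w ∈ ws, w ≤ 1) :
    binPackingOpt ws ≤ ws.length :=
  Nat.sInf_le (exists_packing ws h)

/-- If the items in any unit-sized bin have total `g`-weight at most `ρ`, then all items have total
`g`-weight at most `ρ` times the bin-packing optimum. -/
theorem sum_map_le_mul_binPackingOpt {g : ℝ → ℝ} {ρ : ℝ}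
    (hg : ∀ {n : ℕ} (w : Fin n → ℝ) (s : Finset (Fin n)), (∀ i, 0 ≤ w i ∧ w i ≤ 1) →
      ∑ i ∈ s, w i ≤ 1 → ∑ i ∈ s, g (w i) ≤ ρ)
    (ws : List ℝ) (h : ∀ w ∈ ws, 0 ≤ w ∧ w ≤ 1) : (ws.map g).sum ≤ ρ * binPackingOpt ws := by
  obtain ⟨f, hf⟩ : ∃ f : Fin ws.length → Fin (binPackingOpt ws),
      ∀ j, ∑ i with f i = j, ws.get i ≤ 1 :=
    Nat.sInf_mem (s := {k : ℕ | ∃ f : Fin ws.length → Fin k,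
      ∀ j : Fin k, ∑ i with f i = j, ws.get i ≤ 1}) ⟨_, exists_packing ws fun w hw => (h w hw).2⟩
  have hsum : (ws.map g).sum = ∑ i, g (ws.get i) := by
    rw [← List.sum_ofFn]
    congr 1
    conv_lhs => rw [← List.ofFn_get ws]
    rw [List.map_ofFn]
    rfl
  rw [hsum, ← Finset.sum_fiberwise Finset.univ f]
  calc ∑ j, ∑ i with f i = j, g (ws.get i) ≤ ∑ _j : Fin (binPackingOpt ws), ρ :=
        Finset.sum_le_sum fun j _ => hg ws.get _ (fun i => h _ (List.get_mem _ _)) (hf j)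
    _ = ρ * binPackingOpt ws := by simp [mul_comm]

theorem binPackingOpt_le_maxBins (σ : List (Edge V)) (v : V) :
    binPackingOpt (incidentWeights σ v) ≤ maxBins σ := by
  refine le_ciSup (f := fun v => binPackingOpt (incidentWeights σ v)) ⟨σ.length, ?_⟩ v
  rintro _ ⟨u, rfl⟩
  refine (binPackingOpt_le_length _ fun w hw => (mem_incidentWeights hw).2).trans ?_
  rw [incidentWeights, List.length_map]
  exact List.length_filter_le _ _

open Classical in
theorem finite_neighbors_and_ncard_le (σ : List (Edge V)) (v : V) :
    (neighbors σ v).Finite ∧ (neighbors σ v).ncard ≤ σ.length := by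
  have hmaps : Set.MapsTo (fun u => s(v, u)) (neighbors σ v) ((σ.map Edge.ends).toFinset : Set _) := by
    rintro u ⟨e, he, heu⟩
    simp only [List.coe_toFinset, List.mem_map]
    exact ⟨e, he, heu⟩
  have hinj : Set.InjOn (fun u => s(v, u)) (neighbors σ v) := fun a _ b _ hab =>
    Sym2.congr_right.1 hab
  refine ⟨Set.Finite.of_injOn hmaps hinj (Finset.finite_toSet _), ?_⟩
  refine (Set.ncard_le_ncard_of_injOn _ hmaps hinj (Finset.finite_toSet _)).trans ?_
  rw [Set.ncard_coe_finset]
  exact (List.toFinset_card_le _).trans_eq (List.length_map _)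

theorem ncard_neighbors_le_maxNeighbors (σ : List (Edge V)) (v : V) :
    (neighbors σ v).ncard ≤ maxNeighbors σ := by
  refine le_ciSup (f := fun v => (neighbors σ v).ncard) ⟨σ.length, ?_⟩ v
  rintro _ ⟨u, rfl⟩
  exact (finite_neighbors_and_ncard_le σ u).2

theorem sum_map_filter {α : Type*} (M : List α) (P : α → Prop) [DecidablePred P] (f : α → ℝ) :
    ((M.filter (fun p => P p)).map f).sum = (M.map (fun p => if P p then f p else 0)).sum := by
  induction M with
  | nil => rfl
  | cons x M ih => by_cases h : P x <;> simp [h, ih]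

open Classical in
/-- The bins of a vertex that are given by the colors of a proper coloring. -/
theorem binPackingOpt_map_weight_le (M : List (Edge V × ℕ)) (k : ℕ)
    (hM : ∀ p ∈ M, 1 ≤ p.2 ∧ p.2 ≤ k)
    (hload : ∀ c, ((M.filter (fun p => p.2 = c)).map (fun p => p.1.weight)).sum ≤ 1) :
    binPackingOpt (M.map (fun p => p.1.weight)) ≤ k := by
  have hlen := List.length_map (as := M) (fun p : Edge V × ℕ => p.1.weight)
  have hk : ∀ i : Fin M.length, (M.get i).2 - 1 < k := fun i => by
    have := hM _ (List.get_mem M i)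
    omega
  -- Colors start at `1` and bins at `0`, so color `c` becomes bin `c - 1`.
  refine Nat.sInf_le ⟨fun i => ⟨(M.get (finCongr hlen i)).2 - 1, hk _⟩, fun j => ?_⟩
  refine le_trans (le_of_eq ?_) (hload (j + 1))
  rw [Finset.sum_filter, Fintype.sum_equiv (finCongr hlen) _
    (fun i : Fin M.length => if (M.get i).2 = j + 1 then (M.get i).1.weight else 0)]
  · rw [sum_map_filter, ← List.sum_ofFn]
    congr 1
    conv_rhs => rw [← List.ofFn_get M]
    rw [List.map_ofFn]
    rfl
  · intro i
    have := hM _ (List.get_mem M (finCongr hlen i))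
    refine if_congr ?_ (by simp) rfl
    rw [Fin.ext_iff]
    dsimp only
    omega

theorem maxBins_le_of_isProperColoring {σ : List (Edge V)} {L : List (Edge V × ℕ)} {k : ℕ}
    (h : IsProperColoring σ L k) : maxBins σ ≤ k := by
  classical
  refine ciSup_le' fun v => ?_
  rw [← h.1, incidentWeights_map_fst]
  refine binPackingOpt_map_weight_le _ _ (fun p hp => h.2.1 p (List.mem_of_mem_filter hp)) fun c => ?_
  have := h.2.2 v c
  unfold load at this
  rw [List.filter_filter]
  refine le_of_eq_of_le ?_ this
  congr 2
  refine List.filter_congr fun x _ => ?_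
  simp [and_comm]

/-- The given coloring only ensures that the infimum is attained; over an empty set it would be `0`.
-/
theorem maxBins_le_optColors {σ : List (Edge V)} {L : List (Edge V × ℕ)} {k : ℕ}
    (h : IsProperColoring σ L k) : maxBins σ ≤ optColors σ := by
  obtain ⟨L', hL'⟩ := Nat.sInf_mem (s := {k : ℕ | ∃ L, IsProperColoring σ L k}) ⟨k, L, h⟩
  exact maxBins_le_of_isProperColoring hL'

theorem numColors_le {σ : List (Edge V)} {L : List (Edge V × ℕ)} {k : ℕ}
    (h : IsProperColoring σ L k) : numColors L ≤ k := by
  unfold numColors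
  refine (Finset.card_le_card (t := Finset.Icc 1 k) fun c hc => ?_).trans_eq (by simp)
  obtain ⟨p, hp, rfl⟩ := List.mem_map.1 (List.mem_toFinset.1 hc)
  exact Finset.mem_Icc.2 (h.2.1 p hp)

end Parameters

/-! ### Counting the colors used at the ends of an edge -/

section Counting

open Classical in
-- The other end of an edge at `v` is unique, so each edge is counted for at most one `u ∈ N`.
theorem sum_pairSum_le {g : ℝ → ℝ} (hg : ∀ w, 0 ≤ w → 0 ≤ g w) (L : List (Edge V × ℕ)) (v : V)
    (N : Finset V) :
    ∑ u ∈ N, pairSum g L s(v, u) ≤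
      ((L.filter (fun x => v ∈ x.1.ends)).map (fun x => g x.1.weight)).sum := by
  induction L using List.reverseRecOn with
  | nil => simp [pairSum]
  | append_singleton L x ih =>
    obtain ⟨e, c⟩ := x
    simp only [pairSum_append, Finset.sum_add_distrib, List.filter_append, List.map_append,
      List.sum_append]
    refine add_le_add ih ?_
    have hge := hg _ e.weight_nonneg
    by_cases hv : v ∈ e.ends
    · obtain ⟨u₀, hu₀⟩ := hv
      have : ∀ u, (e.ends = s(v, u)) ↔ u₀ = u := fun u => by rw [hu₀]; exact Sym2.congr_right
      simp only [this, Finset.sum_ite_eq]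
      rw [List.filter_cons_of_pos (by simp [hu₀])]
      split_ifs <;> simp [hge]
    · rw [List.filter_cons_of_neg (by simpa using hv), Finset.sum_eq_zero]
      · simp
      · intro u _
        rw [if_neg]
        intro he
        exact hv (by simp [he])

theorem State.Sound.ncard_used_le {typ : ℝ → κ} {T : Finset κ} {g h : ℝ → ℝ} {s : State V κ}
    (hc : IsCharging typ T g h) (hs : s.Sound typ) (hp : s.Paid T g h) (v : V) :
    ({c | ¬ s.IsEmptyFor v c}.ncard : ℝ) ≤ ((incidentWeights (s.colored.map Prod.fst) v).map g).sum +
      T.card * (neighbors (s.colored.map Prod.fst) v).ncard := by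
  classical
  have hfin := (finite_neighbors_and_ncard_le (s.colored.map Prod.fst) v).1
  set N := hfin.toFinset with hN
  -- The default `0` for a missing open color is harmless: it only enlarges the covering set, and
  -- the image still has at most `T.card` elements.
  have hsub : {c | ¬ s.IsEmptyFor v c} ⊆ ⋃ u ∈ N, (s.closedColors s(v, u) ∪
      ((T.image fun i => (s.openColor s(v, u) i).getD 0 : Finset ℕ) : Set ℕ)) := by
    intro c hcu
    obtain ⟨p, ⟨u, rfl⟩, hpc⟩ := State.not_isEmptyFor_iff.1 hcu
    rcases hpc with ⟨i, hi⟩ | hpc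
    · obtain ⟨x, hx, hxe, hxi, -⟩ := hs.exists_of_open hi
      refine Set.mem_biUnion (x := u) ?_ (.inr ?_)
      · simpa [N, neighbors] using ⟨x.1, ⟨x.2, hx⟩, hxe⟩
      · refine Finset.mem_coe.2 (Finset.mem_image.2 ⟨i, ?_, by simp [hi]⟩)
        exact hxi ▸ hc.typ_mem _ x.1.weight_nonneg x.1.weight_le_one
    · obtain ⟨x, hx, hxe, -⟩ := hs.exists_of_closed hpc
      refine Set.mem_biUnion (x := u) ?_ (.inl hpc)
      simpa [N, neighbors] using ⟨x.1, ⟨x.2, hx⟩, hxe⟩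
  have hfinU : (⋃ u ∈ N, (s.closedColors s(v, u) ∪
      ((T.image fun i => (s.openColor s(v, u) i).getD 0 : Finset ℕ) : Set ℕ))).Finite :=
    N.finite_toSet.biUnion fun u _ => (hs.finite_closed _).union (Finset.finite_toSet _)
  have h1 : {c | ¬ s.IsEmptyFor v c}.ncard ≤ ∑ u ∈ N, ((s.closedColors s(v, u)).ncard + T.card) := by
    refine (Set.ncard_le_ncard hsub hfinU).trans ((Finset.set_ncard_biUnion_le _ _).trans ?_)
    refine Finset.sum_le_sum fun u _ => (Set.ncard_union_le _ _).trans ?_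
    rw [Set.ncard_coe_finset]
    exact Nat.add_le_add_left Finset.card_image_le _
  have h2 : ∀ u ∈ N, ((s.closedColors s(v, u)).ncard : ℝ) ≤ pairSum g s.colored s(v, u) := by
    intro u _
    have h3 : 0 ≤ ∑ i ∈ T, s.openSum h s(v, u) i := by
      refine Finset.sum_nonneg fun i _ => ?_
      unfold State.openSum
      cases s.openColor s(v, u) i with
      | none => exact le_rfl
      | some d => exact pairColorSum_nonneg hc.nonneg _ _ _
    linarith [hp s(v, u)]
  have h4 : ((incidentWeights (s.colored.map Prod.fst) v).map g).sum =
      ((s.colored.filter (fun x => v ∈ x.1.ends)).map (fun x => g x.1.weight)).sum := by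
    rw [incidentWeights_map_fst, List.map_map]
    rfl
  have h5 : (neighbors (s.colored.map Prod.fst) v).ncard = N.card := Set.ncard_eq_toFinset_card _ hfin
  rw [h4, h5]
  calc ({c | ¬ s.IsEmptyFor v c}.ncard : ℝ)
      ≤ ∑ u ∈ N, (((s.closedColors s(v, u)).ncard : ℝ) + T.card) := by exact_mod_cast h1
    _ ≤ ∑ u ∈ N, (pairSum g s.colored s(v, u) + T.card) :=
        Finset.sum_le_sum fun u hu => add_le_add_left (h2 u hu) _
    _ = ∑ u ∈ N, pairSum g s.colored s(v, u) + T.card * N.card := by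
        simp [Finset.sum_add_distrib, mul_comm]
    _ ≤ _ := add_le_add_left
        (sum_pairSum_le (fun w hw => (hc.nonneg w hw).trans (hc.le w hw)) s.colored v N) _

/-- By `below`, the used colors of the two ends together cover `1, …, x.2`. This is where the factor
`2` in the color bounds arises. -/
theorem State.Sound.le_ncard_add_ncard {typ : ℝ → κ} {s : State V κ} (hs : s.Sound typ)
    {x : Edge V × ℕ} (hx : x ∈ s.colored) {u v : V} (huv : x.1.ends = s(u, v)) :
    x.2 ≤ {c | ¬ s.IsEmptyFor u c}.ncard + {c | ¬ s.IsEmptyFor v c}.ncard := by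
  have hsub : (Finset.Icc 1 x.2 : Set ℕ) ⊆ {c | ¬ s.IsEmptyFor u c} ∪ {c | ¬ s.IsEmptyFor v c} := by
    intro c hc
    obtain ⟨h1, h2⟩ := Finset.mem_Icc.1 (Finset.mem_coe.1 hc)
    obtain ⟨w, hw, hwc⟩ := hs.below hx h1 h2
    rcases Sym2.mem_iff.1 (huv ▸ hw) with rfl | rfl
    exacts [.inl hwc, .inr hwc]
  have := (Set.ncard_le_ncard hsub ((hs.finite_used u).union (hs.finite_used v))).trans
    (Set.ncard_union_le _ _)
  rwa [Set.ncard_coe_finset, Nat.card_Icc, Nat.add_sub_cancel] at this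

/-- A charging with bin constant `ρ` bounds the colors of the online coloring. -/
theorem isProperColoring_onlineColoring {typ : ℝ → κ} {T : Finset κ} {g h : ℝ → ℝ} {ρ : ℝ}
    (hc : IsCharging typ T g h) (hρ : 0 ≤ ρ)
    (hg : ∀ {n : ℕ} (w : Fin n → ℝ) (s : Finset (Fin n)), (∀ i, 0 ≤ w i ∧ w i ≤ 1) →
      ∑ i ∈ s, w i ≤ 1 → ∑ i ∈ s, g (w i) ≤ ρ)
    (σ : List (Edge V)) {k : ℕ}
    (hk : ⌊ρ * (2 * (maxBins σ : ℝ)) + 2 * T.card * (maxNeighbors σ : ℝ)⌋₊ ≤ k) :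
    IsProperColoring σ (onlineColoring typ σ) k := by
  have hs := sound_foldl typ σ
  have hp := paid_foldl hc σ
  have hfst : (σ.foldl (State.step typ) State.init).colored.map Prod.fst = σ :=
    map_fst_onlineColoring typ σ
  refine ⟨hfst, fun x hx => ⟨hs.pos hx, le_trans (Nat.le_floor ?_) hk⟩, hs.load_le⟩
  have hN : ∀ v, ({c | ¬ (σ.foldl (State.step typ) State.init).IsEmptyFor v c}.ncard : ℝ) ≤
      ρ * maxBins σ + T.card * maxNeighbors σ := by
    intro v
    refine (hs.ncard_used_le hc hp v).trans ?_
    rw [hfst]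
    refine add_le_add ((sum_map_le_mul_binPackingOpt hg _ fun w hw => mem_incidentWeights hw).trans ?_) ?_
    · exact mul_le_mul_of_nonneg_left (Nat.cast_le.2 (binPackingOpt_le_maxBins σ v)) hρ
    · exact mul_le_mul_of_nonneg_left (Nat.cast_le.2 (ncard_neighbors_le_maxNeighbors σ v))
        (Nat.cast_nonneg _)
  obtain ⟨⟨u, v⟩, huv⟩ := Sym2.mk_surjective x.1.ends
  have := hs.le_ncard_add_ncard hx huv.symm
  have h2 : (x.2 : ℝ) ≤ {c | ¬ (σ.foldl (State.step typ) State.init).IsEmptyFor u c}.ncard +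
      {c | ¬ (σ.foldl (State.step typ) State.init).IsEmptyFor v c}.ncard := by exact_mod_cast this
  linarith [hN u, hN v]

end Counting

/-! ### Charging functions for NEXT-FIT and HARMONIC -/

/-- An edge of weight `x` is charged twice: once to complete the payment for the color that it
overfills, and once as the initial open sum of its own color. -/
theorem isCharging_nextFit :
    IsCharging (fun _ => ()) Finset.univ (fun w : ℝ => 2 * w) (fun w => w) where
  typ_mem _ _ _ := Finset.mem_univ _
  nonneg _ hw := hw
  le w hw := by linarith
  closing ws x _ _ _ h := by
    rw [List.map_id']
    linarith

/-- The weight function of HARMONIC with `12` types. -/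
noncomputable def harmonicWeight (w : ℝ) : ℝ :=
  if w ≤ 1 / 12 then 12 / 11 * w else 1 / (⌊1 / w⌋₊ : ℝ)

theorem harmonicWeight_nonneg {w : ℝ} (hw : 0 ≤ w) : 0 ≤ harmonicWeight w := by
  unfold harmonicWeight
  split_ifs <;> positivity

theorem harmonicType_of_le {w : ℝ} (h : w ≤ 1 / 12) : harmonicType 12 w = 12 := by
  simp only [harmonicType, Nat.cast_ofNat, h, if_true]

theorem harmonicType_of_lt {w : ℝ} (h : 1 / 12 < w) : harmonicType 12 w = ⌊1 / w⌋₊ := by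
  simp only [harmonicType, Nat.cast_ofNat, h.not_ge, if_false]

theorem floor_one_div_lt {w : ℝ} (h : 1 / 12 < w) : ⌊1 / w⌋₊ < 12 := by
  have h0 : 0 < w := by linarith
  rw [Nat.floor_lt (by positivity), div_lt_iff₀ h0]
  norm_num
  linarith

theorem one_le_floor_one_div {w : ℝ} (h0 : 0 < w) (h : w ≤ 1) : 1 ≤ ⌊1 / w⌋₊ := by
  rw [Nat.one_le_floor_iff, le_div_iff₀ h0]
  linarith

/-- A closed color already holds harmonic weight at least `1`. In type `12` its load exceeds
`11/12`, whence the slope `12/11`. In type `i < 12` its items and the arriving one have size at most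
`1/i` and total above `1`, so the color has at least `i` items, each of harmonic weight `1/i`. -/
theorem isCharging_harmonic :
    IsCharging (harmonicType 12) (Finset.Icc 1 12) harmonicWeight harmonicWeight where
  typ_mem w h0 h1 := by
    rw [Finset.mem_Icc]
    rcases le_or_gt w (1 / 12) with h | h
    · simp [harmonicType_of_le h]
    · rw [harmonicType_of_lt h]
      exact ⟨one_le_floor_one_div (by linarith) h1, (floor_one_div_lt h).le⟩
  nonneg _ := harmonicWeight_nonneg
  le _ _ := le_rfl
  closing ws x hws hx0 hx1 h := by
    suffices 1 ≤ (ws.map harmonicWeight).sum by linarith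
    rcases le_or_gt x (1 / 12) with hx | hx
    · have hle : ∀ w ∈ ws, w ≤ 1 / 12 := by
        intro w hw
        by_contra! hlt
        have := (hws w hw).2.2
        rw [harmonicType_of_le hx, harmonicType_of_lt hlt] at this
        exact (floor_one_div_lt hlt).ne this
      have : ws.map harmonicWeight = ws.map (fun w => 12 / 11 * w) :=
        List.map_congr_left fun w hw => if_pos (hle w hw)
      rw [this, List.sum_map_mul_left, List.map_id']
      linarith
    · have hpos : 0 < x := by linarith
      have hi := one_le_floor_one_div hpos hx1
      have hi12 := floor_one_div_lt hx
      have htx := harmonicType_of_lt hx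
      have hxi : x ≤ 1 / (⌊1 / x⌋₊ : ℝ) := by
        rw [le_div_iff₀ (by exact_mod_cast hi), mul_comm, ← le_div_iff₀ hpos]
        exact Nat.floor_le (by positivity)
      generalize ⌊1 / x⌋₊ = i at *
      have hir : (0 : ℝ) < i := by exact_mod_cast hi
      have hlt : ∀ w ∈ ws, 1 / 12 < w ∧ ⌊1 / w⌋₊ = i := by
        intro w hw
        have htw := (hws w hw).2.2
        have hgt : 1 / 12 < w := by
          by_contra! hle
          rw [harmonicType_of_le hle, htx] at htw
          omega
        rw [harmonicType_of_lt hgt, htx] at htw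
        exact ⟨hgt, htw⟩
      have hle : ∀ w ∈ ws, w ≤ 1 / (i : ℝ) := by
        intro w hw
        obtain ⟨h1, h2⟩ := hlt w hw
        have hw0 : 0 < w := by linarith
        rw [le_div_iff₀ hir, mul_comm, ← le_div_iff₀ hw0, ← h2]
        exact Nat.floor_le (by positivity)
      have hmap : ws.map harmonicWeight = ws.map (fun _ => 1 / (i : ℝ)) := by
        refine List.map_congr_left fun w hw => ?_
        rw [harmonicWeight, if_neg (hlt w hw).1.not_ge, (hlt w hw).2]
      have hsum := List.sum_le_card_nsmul ws _ hle
      rw [hmap, List.map_const', List.sum_replicate]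
      rw [nsmul_eq_mul] at hsum ⊢
      have hlen : (i : ℝ) < ws.length + 1 := by
        have : 1 < (ws.length + 1) * (1 / (i : ℝ)) := by linarith
        rwa [mul_one_div, lt_div_iff₀ hir, one_mul] at this
      have hlen' : i ≤ ws.length := by
        have : i < ws.length + 1 := by exact_mod_cast hlen
        omega
      rw [mul_one_div, le_div_iff₀ hir, one_mul]
      exact_mod_cast hlen'

/-! ### Harmonic weight of a unit bin -/

/-- An item in `(1/(k+1), 1/k]` has weight per size below `(k+1)/k = 1 + 1/k`, which decreases in `k
≥ n`; small items have ratio `12/11 = 1 + 1/11`. -/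
theorem harmonicWeight_le {n : ℕ} (h1 : 1 ≤ n) (hn : n ≤ 11) {w : ℝ} (h0 : 0 ≤ w)
    (hw : w ≤ 1 / n) : harmonicWeight w ≤ (1 + 1 / n) * w := by
  have hnr : (0 : ℝ) < n := by exact_mod_cast h1
  have hn11 : (n : ℝ) ≤ 11 := by exact_mod_cast hn
  unfold harmonicWeight
  split_ifs with h
  · refine mul_le_mul_of_nonneg_right ?_ h0
    have : (1 : ℝ) / 11 ≤ 1 / n := one_div_le_one_div_of_le hnr hn11
    linarith
  · have hpos : 0 < w := by linarith
    have hnk : n ≤ ⌊1 / w⌋₊ := by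
      refine Nat.le_floor ?_
      rwa [le_div_iff₀ hpos, mul_comm, ← le_div_iff₀ hnr]
    have hk := Nat.lt_floor_add_one (1 / w)
    generalize ⌊1 / w⌋₊ = k at *
    have hnk' : (n : ℝ) ≤ k := by exact_mod_cast hnk
    have hkr : (0 : ℝ) < k := by linarith
    rw [div_lt_iff₀ hpos] at hk
    have h2 : 1 / (k : ℝ) ≤ (1 + 1 / k) * w := by
      rw [div_le_iff₀ hkr]
      have : (1 + 1 / (k : ℝ)) * w * k = (k + 1) * w := by field_simp
      linarith
    exact h2.trans (mul_le_mul_of_nonneg_right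
      (add_le_add_right (one_div_le_one_div_of_le hnr hnk') _) h0)

theorem harmonicWeight_eq {n : ℕ} (h1 : 1 ≤ n) (hn : n ≤ 11) {w : ℝ} (hlt : 1 / ((n : ℝ) + 1) < w)
    (hle : w ≤ 1 / n) : harmonicWeight w = 1 / n := by
  have hnr : (0 : ℝ) < n := by exact_mod_cast h1
  have hn11 : (n : ℝ) ≤ 11 := by exact_mod_cast hn
  have hpos : 0 < w := lt_trans (by positivity) hlt
  have h12 : 1 / 12 < w := lt_of_le_of_lt (one_div_le_one_div_of_le (by linarith) (by linarith)) hlt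
  have : ⌊1 / w⌋₊ = n := by
    rw [Nat.floor_eq_iff (by positivity)]
    constructor
    · rwa [le_div_iff₀ hpos, mul_comm, ← le_div_iff₀ hnr]
    · rwa [div_lt_iff₀ hpos, mul_comm, ← div_lt_iff₀ (by linarith)]
  rw [harmonicWeight, if_neg h12.not_ge, this]

theorem sum_harmonicWeight_le {ι : Type*} {w : ι → ℝ} (h0 : ∀ i, 0 ≤ w i) {s : Finset ι} {n : ℕ}
    (h1 : 1 ≤ n) (hn : n ≤ 11) (hs : ∀ i ∈ s, w i ≤ 1 / n) :
    ∑ i ∈ s, harmonicWeight (w i) ≤ (1 + 1 / n) * ∑ i ∈ s, w i := by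
  rw [Finset.mul_sum]
  exact Finset.sum_le_sum fun i hi => harmonicWeight_le h1 hn (h0 i) (hs i hi)

/-- The items in a unit-sized bin have total harmonic weight at most `1.693`. -/
theorem sum_harmonicWeight_le_of_sum_le_one {ι : Type*} (w : ι → ℝ) (s : Finset ι)
    (h0 : ∀ i, 0 ≤ w i) (hs : ∑ i ∈ s, w i ≤ 1) : ∑ i ∈ s, harmonicWeight (w i) ≤ 1.693 := by
  classical
  have hsingle : ∀ (s : Finset ι), ∀ i ∈ s, w i ≤ ∑ i ∈ s, w i := fun s i hi =>
    Finset.single_le_sum (fun j _ => h0 j) hi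
  -- The worst bin is greedy: items just above `1/2`, `1/3`, `1/7`, which leave less than `1/2`,
  -- `1/6`, `1/42`. If the next such item is missing, the rest is bounded by its density. The four
  -- cases give `3/2`, `1 + (4/3)/2 = 5/3`, `3/2 + (8/7)/6` and `5/3 + (12/11)/42 < 1.693`.
  by_cases hA : ∀ i ∈ s, w i ≤ 1 / (2 : ℕ)
  · have := sum_harmonicWeight_le h0 (by norm_num) (by norm_num) hA
    norm_num at this ⊢
    linarith
  push Not at hA
  obtain ⟨i, hi, hwi⟩ := hA
  have hi1 := hsingle s i hi
  have ei := harmonicWeight_eq (n := 1) (w := w i) le_rfl (by norm_num)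
    (by norm_num at hwi ⊢; linarith) (by norm_num; linarith)
  rw [← Finset.add_sum_erase _ _ hi] at hs ⊢
  rw [ei]
  generalize s.erase i = s at *
  norm_num at hwi
  by_cases hB : ∀ j ∈ s, w j ≤ 1 / (3 : ℕ)
  · have := sum_harmonicWeight_le h0 (by norm_num) (by norm_num) hB
    norm_num at this ⊢
    linarith
  push Not at hB
  obtain ⟨j, hj, hwj⟩ := hB
  have hj1 := hsingle s j hj
  have ej := harmonicWeight_eq (n := 2) (w := w j) (by norm_num) (by norm_num)
    (by norm_num at hwj ⊢; linarith) (by norm_num; linarith)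
  rw [← Finset.add_sum_erase _ _ hj] at hs ⊢
  rw [ej]
  generalize s.erase j = s at *
  norm_num at hwj
  by_cases hC : ∀ k ∈ s, w k ≤ 1 / (7 : ℕ)
  · have := sum_harmonicWeight_le h0 (by norm_num) (by norm_num) hC
    norm_num at this ⊢
    linarith
  push Not at hC
  obtain ⟨k, hk, hwk⟩ := hC
  have hk1 := hsingle s k hk
  have ek := harmonicWeight_eq (n := 6) (w := w k) (by norm_num) (by norm_num)
    (by norm_num at hwk ⊢; linarith) (by norm_num; linarith)
  rw [← Finset.add_sum_erase _ _ hk] at hs ⊢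
  rw [ek]
  generalize s.erase k = s at *
  norm_num at hwk
  have := sum_harmonicWeight_le (n := 11) h0 (s := s) (by norm_num) le_rfl fun l hl => by
    have := hsingle s l hl
    norm_num
    linarith
  norm_num at this ⊢
  linarith

/-! ### The two color bounds -/

theorem isProperColoring_harmonicColoring {V : Type*} (σ : List (Edge V)) :
    IsProperColoring σ (harmonicColoring 12 σ)
      ⌊(1.693 : ℝ) * (2 * (maxBins σ : ℝ)) + 24 * (maxNeighbors σ : ℝ)⌋₊ := by
  refine isProperColoring_onlineColoring isCharging_harmonic (ρ := 1.693) (by norm_num)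
    (fun w s hw hs => sum_harmonicWeight_le_of_sum_le_one w s (fun i => (hw i).1) hs) σ
    (Nat.floor_mono (le_of_eq ?_))
  norm_num

theorem isProperColoring_nextFitColoring {V : Type*} (σ : List (Edge V)) :
    IsProperColoring σ (nextFitColoring σ) (4 * maxBins σ + 2 * maxNeighbors σ) := by
  refine isProperColoring_onlineColoring isCharging_nextFit (ρ := 2) (by norm_num)
    (fun w s _ hs => ?_) σ (Nat.floor_le_of_le (le_of_eq ?_))
  · rw [← Finset.mul_sum]
    linarith
  · push_cast [Finset.card_univ, Fintype.card_unit]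
    ring

/-! ### Asymptotic competitive ratio -/

/-- A bound for all `m`, not just large ones, is needed: a large benchmark value does not by itself
make `m` large. The finitely many exceptions go into `C`. -/
theorem exists_le_mul_add {τ : ℕ → ℝ} (hτ : τ =o[atTop] (fun m : ℕ => (m : ℝ))) {ε : ℝ}
    (hε : 0 < ε) : ∃ C, ∀ m, τ m ≤ ε * m + C := by
  obtain ⟨M, hM⟩ := eventually_atTop.1 (hτ.bound hε)
  refine ⟨∑ i ∈ Finset.range M, |τ i|, fun m => ?_⟩
  have hC : 0 ≤ ∑ i ∈ Finset.range M, |τ i| := Finset.sum_nonneg fun i _ => abs_nonneg _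
  rcases le_or_gt M m with hm | hm
  · have := hM m hm
    rw [Real.norm_eq_abs, Real.norm_of_nonneg (Nat.cast_nonneg m)] at this
    linarith [le_abs_self (τ m)]
  · have := Finset.single_le_sum (f := fun i => |τ i|) (fun i _ => abs_nonneg _)
      (Finset.mem_range.2 hm)
    have h2 : 0 ≤ ε * m := by positivity
    linarith [le_abs_self (τ m)]

theorem asymptoticRatio_le {V : Type*} {τ : ℕ → ℝ} (hτ : τ =o[atTop] (fun m : ℕ => (m : ℝ)))
    {alg bench : List (Edge V) → ℕ} {a b : ℝ} (ha : 0 ≤ a) (hb : 0 ≤ b)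
    (halg : ∀ σ, (alg σ : ℝ) ≤ a * maxBins σ + b * maxNeighbors σ)
    (hbench : ∀ σ, maxBins σ ≤ bench σ) :
    asymptoticRatio (instancesWithNeighborBound V τ) alg bench ≤ ENNReal.ofReal a := by
  refine ENNReal.le_of_forall_pos_le_add fun ε hε _ => ?_
  have hε' : (0 : ℝ) < ε := hε
  have hb1 : 0 < b + 1 := by linarith
  -- Half of the slack `ε` absorbs the linear part of `b * t`, the other half the constant `b * C`
  -- once `n` is large. Using `b + 1` avoids division by zero.
  obtain ⟨C, hC⟩ := exists_le_mul_add hτ (ε := ε / (2 * (b + 1))) (by positivity)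
  refine limsup_le_of_le (by isBoundedDefault) ?_
  filter_upwards [eventually_ge_atTop ⌈b * C / (ε / 2)⌉₊, eventually_gt_atTop 0] with n hn hn0
  refine iSup₂_le fun σ ⟨hσ, hσn⟩ => ?_
  rw [hσn]
  refine ENNReal.div_le_of_le_mul ?_
  have hnC : b * C ≤ ε / 2 * n := by
    have := Nat.ceil_le.1 hn
    rw [div_le_iff₀ (by positivity)] at this
    linarith
  have hmn : (maxBins σ : ℝ) ≤ n := by exact_mod_cast hσn ▸ hbench σ
  have ht : (maxNeighbors σ : ℝ) ≤ ε / (2 * (b + 1)) * maxBins σ + C := le_trans hσ (hC _)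
  have h1 : b * maxNeighbors σ ≤ b * (ε / (2 * (b + 1)) * maxBins σ + C) :=
    mul_le_mul_of_nonneg_left ht hb
  have h2 : b * (ε / (2 * (b + 1))) ≤ ε / 2 := by
    rw [mul_div_assoc', div_le_div_iff₀ (by positivity) (by norm_num)]
    nlinarith
  have h3 : b * (ε / (2 * (b + 1))) * maxBins σ ≤ ε / 2 * n :=
    mul_le_mul h2 hmn (Nat.cast_nonneg _) (by positivity)
  have h4 : a * maxBins σ ≤ a * n := mul_le_mul_of_nonneg_left hmn ha
  have key : (alg σ : ℝ) ≤ (a + ε) * n := by linarith [halg σ]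
  have := ENNReal.ofReal_le_ofReal key
  rwa [ENNReal.ofReal_natCast, ENNReal.ofReal_mul (by positivity), ENNReal.ofReal_natCast,
    ENNReal.ofReal_add ha hε'.le, ENNReal.ofReal_coe_nnreal] at this

end OnlineColoring

theorem theorem1 {V : Type*} :
    (∀ σ : List (OnlineColoring.Edge V),
      OnlineColoring.IsProperColoring σ (OnlineColoring.harmonicColoring 12 σ)
        ⌊(1.693 : ℝ) * (2 * (OnlineColoring.maxBins σ : ℝ))
          + 24 * (OnlineColoring.maxNeighbors σ : ℝ)⌋₊ ∧
      OnlineColoring.IsProperColoring σ (OnlineColoring.nextFitColoring σ)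
        (4 * OnlineColoring.maxBins σ + 2 * OnlineColoring.maxNeighbors σ)) ∧
    (∀ τ : ℕ → ℝ, τ =o[atTop] (fun m : ℕ => (m : ℝ)) →
      ∀ bench : List (OnlineColoring.Edge V) → ℕ,
        bench = OnlineColoring.optColors ∨ bench = OnlineColoring.maxBins →
      OnlineColoring.asymptoticRatio (OnlineColoring.instancesWithNeighborBound V τ)
          (fun σ => OnlineColoring.numColors (OnlineColoring.harmonicColoring 12 σ)) bench
        ≤ ENNReal.ofReal (1.693 * 2) ∧
      OnlineColoring.asymptoticRatio (OnlineColoring.instancesWithNeighborBound V τ)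
          (fun σ => OnlineColoring.numColors (OnlineColoring.harmonicColoring 12 σ)) bench
        < ENNReal.ofReal 3.39 ∧
      OnlineColoring.asymptoticRatio (OnlineColoring.instancesWithNeighborBound V τ)
          (fun σ => OnlineColoring.numColors (OnlineColoring.nextFitColoring σ)) bench
        ≤ 4) := by
  refine ⟨fun σ => ⟨OnlineColoring.isProperColoring_harmonicColoring σ,
    OnlineColoring.isProperColoring_nextFitColoring σ⟩, fun τ hτ bench hbench => ?_⟩
  have hle : ∀ σ, OnlineColoring.maxBins σ ≤ bench σ := by
    intro σ
    rcases hbench with rfl | rfl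
    · exact OnlineColoring.maxBins_le_optColors (OnlineColoring.isProperColoring_nextFitColoring σ)
    · exact le_rfl
  have hH := OnlineColoring.asymptoticRatio_le hτ (a := 1.693 * 2) (b := 24)
    (alg := fun σ => OnlineColoring.numColors (OnlineColoring.harmonicColoring 12 σ))
    (by norm_num) (by norm_num) (fun σ => by
      have h := OnlineColoring.numColors_le (OnlineColoring.isProperColoring_harmonicColoring σ)
      rw [mul_assoc]
      exact (Nat.le_floor_iff (by positivity)).1 h) hle
  refine ⟨hH, hH.trans_lt ?_, ?_⟩
  · rw [ENNReal.ofReal_lt_ofReal_iff (by norm_num)]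
    norm_num
  · have hN := OnlineColoring.asymptoticRatio_le hτ (a := 4) (b := 2)
      (alg := fun σ => OnlineColoring.numColors (OnlineColoring.nextFitColoring σ))
      (by norm_num) (by norm_num) (fun σ => by
        have h := OnlineColoring.numColors_le (OnlineColoring.isProperColoring_nextFitColoring σ)
        exact_mod_cast h) hle
    simpa using hN
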